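/- Let $G$ be a locally compact (Hausdorff) group, $N$ a closed normal subgroup of $G$, and $\xi:N\to\mathbb{T}$ a continuous character that is $G$-invariant, i.e. $\xi(x^{-1}sx)=\xi(s)$ for all $x\in G$, $s\in N$. Let $\lambda_{G/N}$ be a left Haar measure on $G/N$ and $\Delta_{G/N}$ the modular function of $G/N$ (with $\lambda_{G/N}(Eq)=\Delta_{G/N}(q)\lambda_{G/N}(E)$). Let $\mathcal{C}_\xi(G,N)$ be the space of continuous functions $\psi:G\to\mathbb{C}$ such that the image of $\mathrm{supp}(\psi)$ in $G/N$ is compact and $\psi(xs)=\xi(s)\psi(x)$ for all $x\in G$, $s\in N$, with the norm $\|\psi\|_{(1)}=\int_{G/N}|\psi(x)|\,\mathrm{d}\lambda_{G/N}(xN)$, and let $L^1_\xi(G,N)$ be its Banach completion. For $\psi,\phi\in\mathcal{C}_\xi(G,N)$ the functions $$\psi\natural\phi(x)=\int_{G/N}\psi(y)\phi(y^{-1}x)\,\mathrm{d}\lambda_{G/N}(yN),\qquad \psi^\natural(x)=\Delta_{G/N}(x^{-1}N)\overline{\psi(x^{-1})}\qquad(x\in G)$$ again belong to $\mathcal{C}_\xi(G,N)$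 (covariant convolution and covariant involution). Theorem. For all $\psi,\phi\in\mathcal{C}_\xi(G,N)$ we have $\|\psi^\natural\|_{(1)}=\|\psi\|_{(1)}$, $(\psi^\natural)^\natural=\psi$ and $(\psi\natural\phi)^\natural=\phi^\natural\natural\psi^\natural$. The covariant convolution has a unique jointly continuous extension $\natural:L^1_\xi(G,N)\times L^1_\xi(G,N)\to L^1_\xi(G,N)$. The covariant involution extends to an isometric involution ${}^\natural:L^1_\xi(G,N)\to L^1_\xi(G,N)$, which is its only continuous (in particular its only isometric) extension, and with these two operations $L^1_\xi(G,N)$ is a Banach $*$-algebra; that is, $L^1_\xi(G,N)$ is complete, $\natural$ is bilinear, associative and satisfies $\|\psi\natural\phi\|_{(1)}\le\|\psi\|_{(1)}\|\phi\|_{(1)}$, and ${}^\natural$ is conjugate-linear with $(\psi^\natural)^\natural=\psi$, $(\psi\natural\phi)^\natural=\phi^\natural\natural\psi^\natural$ and $\|\psi^\natural\|_{(1)}=\|\psi\|_{(1)}$. -/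

import Mathlib

open MeasureTheory Topology Filter
open scoped ComplexConjugate Pointwise

namespace Covariant

noncomputable section

/-! ### The modular function -/

section Modular

variable {H : Type*} [Group H] [TopologicalSpace H] [IsTopologicalGroup H] [LocallyCompactSpace H]

/-- The modular function `Δ` of a locally compact group, in the convention
`μ (E x) = Δ x * μ E` for left Haar measures `μ`. Mathlib's `modularCharacter` uses the opposite
convention `μ (E x⁻¹) = Δ x * μ E`, whence the inverse. -/
def modularFn (x : H) : ℝ := ((Measure.modularCharacter x)⁻¹ : NNReal)

lemma modularFn_pos (x : H) : 0 < modularFn x :=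
  NNReal.coe_pos.2 (inv_pos.2 (Measure.modularCharacterFun_pos x))

/-- The modular function governs right translation: `∫ f (x y) dx = Δ(y⁻¹) ∫ f (x) dx`. -/
lemma integral_mul_right_eq_modularFn [MeasurableSpace H] [BorelSpace H] (μ : Measure H)
    [μ.IsHaarMeasure] {f : H → ℝ} (hf : Continuous f) (hc : HasCompactSupport f) (y : H) :
    ∫ x, f (x * y) ∂μ = modularFn y⁻¹ * ∫ x, f x ∂μ := by
  have h1 : ∫ x, f (x * y) ∂μ = ∫ x, f x ∂(Measure.map (· * y) μ) :=
    (integral_map (AEMeasurable.mul_const aemeasurable_id' _) hf.aestronglyMeasurable).symm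
  have h2 := Measure.integral_isMulLeftInvariant_eq_smul_of_hasCompactSupport
    (Measure.map (· * y) μ) μ hf hc
  rw [integral_smul_nnreal_measure, ← Measure.modularCharacterFun_eq_haarScalarFactor μ y] at h2
  rw [h1, h2]
  simp only [modularFn, map_inv, inv_inv]
  rfl

lemma continuous_modularFn : Continuous (modularFn : H → ℝ) := by
  borelize H
  let μ : Measure H := Measure.haar
  obtain ⟨⟨f, f_cont⟩, f_comp, f_nonneg, f_one⟩ :
    ∃ f : C(H, ℝ), HasCompactSupport f ∧ 0 ≤ f ∧ f 1 ≠ 0 := exists_continuous_nonneg_pos 1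
  have hpos : 0 < ∫ x, f x ∂μ :=
    f_cont.integral_pos_of_hasCompactSupport_nonneg_nonzero f_comp f_nonneg f_one
  have hF : Continuous fun y : H => ∫ x, f (x * y) ∂μ := by
    rw [continuous_iff_continuousAt]
    intro y₀
    obtain ⟨V, hV, hVn⟩ := exists_compact_mem_nhds y₀
    have : ContinuousOn (fun y : H => ∫ x, f (x * y) ∂μ) V := by
      refine continuousOn_integral_of_compact_support (k := tsupport f * V⁻¹)
        (f_comp.isCompact.mul hV.inv) ?_ ?_
      · exact (f_cont.comp (continuous_snd.mul continuous_fst)).continuousOn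
      · intro p x hp hx
        by_contra hne
        refine hx ⟨x * p, subset_tsupport _ hne, p⁻¹, Set.inv_mem_inv.2 hp, by simp⟩
    exact this.continuousAt hVn
  have hEq : (modularFn : H → ℝ) = fun y => (∫ x, f (x * y⁻¹) ∂μ) / ∫ x, f x ∂μ := by
    funext y
    rw [integral_mul_right_eq_modularFn μ f_cont f_comp, inv_inv, mul_div_assoc, div_self hpos.ne',
      mul_one]
  rw [hEq]
  exact (hF.comp continuous_inv).div_const _

end Modular

/-! ### Functions on `G` as functions on `G ⧸ N` -/

section Descend

variable {G : Type*} [Group G] {N : Subgroup G} {E : Type*}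

/-- The function on `G ⧸ N` whose value at `x N` is `f x`, for a function `f` on `G` that is
constant on the left cosets of `N` (see `descend_mk`). -/
def descend (N : Subgroup G) (f : G → E) (q : G ⧸ N) : E := f q.out

lemma descend_mk {f : G → E} (hf : ∀ x, ∀ s : N, f (x * s) = f x) (x : G) :
    descend N f (x : G ⧸ N) = f x := by
  obtain ⟨s, hs⟩ := QuotientGroup.mk_out_eq_mul N x
  unfold descend
  rw [hs, hf]

lemma continuous_descend [TopologicalSpace G] [IsTopologicalGroup G] [TopologicalSpace E]
    {f : G → E} (hf : ∀ x, ∀ s : N, f (x * s) = f x) (hc : Continuous f) :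
    Continuous (descend N f) := by
  refine QuotientGroup.isOpenQuotientMap_mk.isQuotientMap.continuous_iff.2 ?_
  convert hc using 1
  exact funext fun x => descend_mk hf x

lemma image_tsupport_eq [TopologicalSpace G] [IsTopologicalGroup G] {ψ : G → ℂ}
    (hψ : ∀ x, ∀ s : N, ‖ψ (x * s)‖ = ‖ψ x‖) :
    ((↑) : G → G ⧸ N) '' tsupport ψ = tsupport (descend N fun x => ‖ψ x‖) := by
  have h : Function.support ψ =
      ((↑) : G → G ⧸ N) ⁻¹' Function.support (descend N fun x => ‖ψ x‖) := by
    ext x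
    simp [descend_mk (f := fun x => ‖ψ x‖) hψ]
  rw [tsupport, tsupport, h, ← QuotientGroup.isOpenQuotientMap_mk.isOpenMap
    |>.preimage_closure_eq_closure_preimage QuotientGroup.isOpenQuotientMap_mk.continuous,
    Set.image_preimage_eq _ QuotientGroup.mk_surjective]

end Descend

/-! ### Covariant functions -/

section CovFun

variable {G : Type*} [Group G] [TopologicalSpace G] [IsTopologicalGroup G]
  {N : Subgroup G}

/-- A character `ξ` of the normal subgroup `N` is `G`-invariant if `ξ (x⁻¹ s x) = ξ s` for all
`x ∈ G` and `s ∈ N`. -/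
def IsInvariantChar [hN : N.Normal] (ξ : N →ₜ* Circle) : Prop :=
  ∀ (x : G) (s : N), ξ ⟨x⁻¹ * s * x, hN.conj_mem' s s.2 x⟩ = ξ s

lemma norm_covariant {ξ : N →ₜ* Circle} {ψ : G → ℂ}
    (h : ∀ (x : G) (s : N), ψ (x * s) = ξ s * ψ x) (x : G) (s : N) : ‖ψ (x * s)‖ = ‖ψ x‖ := by
  rw [h, norm_mul, Circle.norm_coe, one_mul]

/-- The space `C_ξ(G, N)` of continuous functions `ψ` on `G` for which the image of the support of
`ψ` in `G ⧸ N` is compact and `ψ (x s) = ξ s * ψ x` for all `x ∈ G`, `s ∈ N`. -/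
def covSubmodule (ξ : N →ₜ* Circle) : Submodule ℂ (G → ℂ) where
  carrier := {ψ | Continuous ψ ∧ IsCompact (((↑) : G → G ⧸ N) '' tsupport ψ) ∧
    ∀ (x : G) (s : N), ψ (x * s) = ξ s * ψ x}
  zero_mem' := ⟨continuous_const, by simp [tsupport], by simp⟩
  add_mem' := by
    rintro ψ φ ⟨hψ, hψc, hψs⟩ ⟨hφ, hφc, hφs⟩
    have hs : ∀ (x : G) (s : N), (ψ + φ) (x * s) = ξ s * (ψ + φ) x := fun x s => by
      simp [hψs, hφs, mul_add]
    refine ⟨hψ.add hφ, (hψc.union hφc).of_isClosed_subset ?_ ?_, hs⟩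
    · rw [image_tsupport_eq (norm_covariant hs)]
      exact isClosed_tsupport _
    · rw [← Set.image_union]
      exact Set.image_mono (tsupport_add ψ φ)
  smul_mem' := by
    rintro c ψ ⟨hψ, hψc, hψs⟩
    have hs : ∀ (x : G) (s : N), (c • ψ) (x * s) = ξ s * (c • ψ) x := fun x s => by
      simp [hψs, mul_left_comm]
    refine ⟨hψ.const_smul c, hψc.of_isClosed_subset ?_ ?_, hs⟩
    · rw [image_tsupport_eq (norm_covariant hs)]
      exact isClosed_tsupport _
    · exact Set.image_mono (closure_mono (Function.support_const_smul_subset c ψ))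

variable [MeasurableSpace (G ⧸ N)]

/-- The space `C_ξ(G, N)`, as a type that carries the norm `‖·‖_(1)` defined by the measure `μ`
on `G ⧸ N`. -/
def CovFun (ξ : N →ₜ* Circle) (_μ : Measure (G ⧸ N)) : Type _ := covSubmodule ξ

variable {ξ : N →ₜ* Circle} {μ : Measure (G ⧸ N)}

namespace CovFun

instance : AddCommGroup (CovFun ξ μ) := inferInstanceAs (AddCommGroup (covSubmodule ξ))

instance : Module ℂ (CovFun ξ μ) := inferInstanceAs (Module ℂ (covSubmodule ξ))

instance : FunLike (CovFun ξ μ) G ℂ where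
  coe ψ := ψ.1
  coe_injective := Subtype.val_injective

lemma continuous (ψ : CovFun ξ μ) : Continuous ψ := ψ.2.1

lemma isCompact_image (ψ : CovFun ξ μ) : IsCompact (((↑) : G → G ⧸ N) '' tsupport ψ) := ψ.2.2.1

lemma map_mul (ψ : CovFun ξ μ) (x : G) (s : N) : ψ (x * s) = ξ s * ψ x := ψ.2.2.2 x s

@[simp] lemma add_apply (ψ φ : CovFun ξ μ) (x : G) : (ψ + φ) x = ψ x + φ x := rfl

@[simp] lemma smul_apply (c : ℂ) (ψ : CovFun ξ μ) (x : G) : (c • ψ) x = c * ψ x := rfl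

@[simp] lemma zero_apply (x : G) : (0 : CovFun ξ μ) x = 0 := rfl

lemma norm_map_mul (ψ : CovFun ξ μ) (x : G) (s : N) : ‖ψ (x * s)‖ = ‖ψ x‖ :=
  norm_covariant ψ.map_mul x s

/-- `‖ψ‖_(1) = ∫_{G/N} |ψ (x)| dμ(xN)`. -/
instance : Norm (CovFun ξ μ) := ⟨fun ψ => ∫ q, descend N (fun x => ‖ψ x‖) q ∂μ⟩

lemma norm_def (ψ : CovFun ξ μ) : ‖ψ‖ = ∫ q, descend N (fun x => ‖ψ x‖) q ∂μ := rfl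

lemma continuous_descend_norm (ψ : CovFun ξ μ) : Continuous (descend N fun x => ‖ψ x‖) :=
  continuous_descend ψ.norm_map_mul ψ.continuous.norm

lemma hasCompactSupport_descend_norm (ψ : CovFun ξ μ) :
    HasCompactSupport (descend N fun x => ‖ψ x‖) := by
  rw [HasCompactSupport, ← image_tsupport_eq ψ.norm_map_mul]
  exact ψ.isCompact_image

variable [BorelSpace (G ⧸ N)]

lemma integrable_descend_norm [IsFiniteMeasureOnCompacts μ] (ψ : CovFun ξ μ) :
    Integrable (descend N fun x => ‖ψ x‖) μ :=
  ψ.continuous_descend_norm.integrable_of_hasCompactSupport ψ.hasCompactSupport_descend_norm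

lemma normCore [IsFiniteMeasureOnCompacts μ] [μ.IsOpenPosMeasure] :
    NormedSpace.Core ℂ (CovFun ξ μ) where
  norm_nonneg ψ := integral_nonneg fun _ => norm_nonneg _
  norm_smul c ψ := by
    rw [norm_def, norm_def, ← integral_const_mul]
    refine integral_congr_ae (ae_of_all _ fun q => ?_)
    simp [descend]
  norm_triangle ψ φ := by
    rw [norm_def, norm_def, norm_def,
      ← integral_add ψ.integrable_descend_norm φ.integrable_descend_norm]
    exact integral_mono (integrable_descend_norm _)
      (ψ.integrable_descend_norm.add φ.integrable_descend_norm) fun q => norm_add_le _ _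
  norm_eq_zero_iff ψ := by
    rw [norm_def, integral_eq_zero_iff_of_nonneg
      (show 0 ≤ descend N (fun x => ‖ψ x‖) from fun q => norm_nonneg (ψ q.out))
      ψ.integrable_descend_norm, ψ.continuous_descend_norm.ae_eq_iff_eq μ continuous_zero]
    constructor
    · intro h
      refine DFunLike.ext _ _ fun x => ?_
      have := congrFun h (x : G ⧸ N)
      rw [descend_mk ψ.norm_map_mul] at this
      simpa using this
    · rintro rfl
      funext q
      simp [descend]

instance [IsFiniteMeasureOnCompacts μ] [μ.IsOpenPosMeasure] : NormedAddCommGroup (CovFun ξ μ) :=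
  NormedAddCommGroup.ofCore normCore

instance [IsFiniteMeasureOnCompacts μ] [μ.IsOpenPosMeasure] : NormedSpace ℂ (CovFun ξ μ) :=
  NormedSpace.ofCore normCore

end CovFun

/-- The Banach space `L¹_ξ(G, N)`: the completion of `C_ξ(G, N)` with respect to `‖·‖_(1)`. -/
abbrev L1Cov [BorelSpace (G ⧸ N)] (ξ : N →ₜ* Circle) (μ : Measure (G ⧸ N))
    [IsFiniteMeasureOnCompacts μ] [μ.IsOpenPosMeasure] : Type _ :=
  UniformSpace.Completion (CovFun ξ μ)

/-! ### Covariant convolution and covariant involution -/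

section Operations

variable [N.Normal]

lemma CovFun.map_mul_left (hξ : IsInvariantChar ξ) (ψ : CovFun ξ μ) (s : N) (x : G) :
    ψ (s * x) = ξ s * ψ x := by
  have h := ψ.map_mul x ⟨x⁻¹ * s * x, (inferInstance : N.Normal).conj_mem' s s.2 x⟩
  rw [hξ x s] at h
  rw [← h]
  congr 1
  simp [mul_assoc]

/-- The integrand `y ↦ ψ y * φ (y⁻¹ x)` of the covariant convolution is constant on cosets. -/
lemma convIntegrand_mul (hξ : IsInvariantChar ξ) (ψ φ : CovFun ξ μ) (x y : G) (s : N) :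
    ψ (y * s) * φ ((y * s)⁻¹ * x) = ψ y * φ (y⁻¹ * x) := by
  have h : (y * (s : G))⁻¹ * x = ((s⁻¹ : N) : G) * (y⁻¹ * x) := by
    simp [mul_assoc]
  rw [h, φ.map_mul_left hξ, ψ.map_mul]
  have h1 : (ξ s : ℂ) * (ξ s⁻¹ : ℂ) = 1 := by
    rw [← Circle.coe_mul, ← _root_.map_mul]
    simp
  linear_combination (ψ y * φ (y⁻¹ * x)) * h1

/-- The covariant convolution `(ψ ♮ φ) x = ∫_{G/N} ψ y * φ (y⁻¹ x) dμ(yN)`, as a function. -/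
def convFun (ψ φ : CovFun ξ μ) (x : G) : ℂ :=
  ∫ q, descend N (fun y => ψ y * φ (y⁻¹ * x)) q ∂μ

/-- The covariant involution `ψ^♮ x = Δ_{G/N}(x⁻¹ N) * conj (ψ x⁻¹)`, as a function. -/
def involFun [LocallyCompactSpace G] (ψ : CovFun ξ μ) (x : G) : ℂ :=
  (modularFn ((x⁻¹ : G) : G ⧸ N) : ℂ) * conj (ψ x⁻¹)

lemma convFun_mem [BorelSpace (G ⧸ N)] [IsFiniteMeasureOnCompacts μ] [IsClosed (N : Set G)]
    (hξ : IsInvariantChar ξ) (ψ φ : CovFun ξ μ) : convFun ψ φ ∈ covSubmodule ξ := by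
  have hcov : ∀ (x : G) (s : N), convFun ψ φ (x * s) = ξ s * convFun ψ φ x := fun x s => by
    unfold convFun
    rw [← integral_const_mul]
    refine integral_congr_ae (ae_of_all _ fun q => ?_)
    simp only [descend]
    rw [← mul_assoc, φ.map_mul]
    ring
  refine ⟨?_, ?_, hcov⟩
  · rw [← continuousOn_univ]
    refine continuousOn_integral_of_compact_support ψ.isCompact_image ?_ ?_
    · refine Continuous.continuousOn ?_
      rw [← (IsOpenQuotientMap.id.prodMap
        (QuotientGroup.isOpenQuotientMap_mk (N := N))).continuous_comp_iff]
      have : Continuous fun p : G × G => ψ p.2 * φ (p.2⁻¹ * p.1) :=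
        (ψ.continuous.comp continuous_snd).mul
          (φ.continuous.comp (continuous_snd.inv.mul continuous_fst))
      convert this using 1
      funext p
      exact descend_mk (f := fun y => ψ y * φ (y⁻¹ * p.1))
        (fun y s => convIntegrand_mul hξ ψ φ p.1 y s) p.2
    · intro x q _ hq
      obtain ⟨y, rfl⟩ := QuotientGroup.mk_surjective q
      rw [descend_mk (f := fun y => ψ y * φ (y⁻¹ * x))
        (fun y s => convIntegrand_mul hξ ψ φ x y s)]
      have : ψ y = 0 := by
        by_contra h
        exact hq ⟨y, subset_tsupport _ h, rfl⟩
      simp [this]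
  · rw [image_tsupport_eq (norm_covariant hcov)]
    refine IsCompact.of_isClosed_subset (ψ.isCompact_image.mul φ.isCompact_image)
      (isClosed_tsupport _) (closure_minimal ?_
        (ψ.isCompact_image.mul φ.isCompact_image).isClosed)
    intro q hq
    obtain ⟨x, rfl⟩ := QuotientGroup.mk_surjective q
    rw [Function.mem_support, descend_mk (f := fun x => ‖convFun ψ φ x‖) (norm_covariant hcov),
      norm_ne_zero_iff] at hq
    by_contra hx
    refine hq (integral_eq_zero_of_ae (ae_of_all _ fun r => ?_))
    change ψ r.out * φ (r.out⁻¹ * x) = 0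
    by_contra h
    refine hx ⟨_, ⟨r.out, subset_tsupport _ (left_ne_zero_of_mul h), rfl⟩, _,
      ⟨r.out⁻¹ * x, subset_tsupport _ (right_ne_zero_of_mul h), rfl⟩, ?_⟩
    change ((r.out : G) : G ⧸ N) * ((r.out⁻¹ * x : G) : G ⧸ N) = _
    rw [← QuotientGroup.mk_mul]
    simp

lemma involFun_mem [LocallyCompactSpace G] (hξ : IsInvariantChar ξ) (ψ : CovFun ξ μ) :
    involFun ψ ∈ covSubmodule ξ := by
  have hcov : ∀ (x : G) (s : N), involFun ψ (x * s) = ξ s * involFun ψ x := fun x s => by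
    have h : (x * (s : G))⁻¹ = ((s⁻¹ : N) : G) * x⁻¹ := by simp
    have hq : (((x * (s : G))⁻¹ : G) : G ⧸ N) = ((x⁻¹ : G) : G ⧸ N) := by
      rw [QuotientGroup.mk_inv, QuotientGroup.mk_inv, QuotientGroup.mk_mul_of_mem _ s.2]
    unfold involFun
    rw [hq, h, ψ.map_mul_left hξ, _root_.map_mul, map_inv, Circle.coe_inv_eq_conj,
      Complex.conj_conj]
    ring
  refine ⟨?_, ?_, hcov⟩
  · exact (Complex.continuous_ofReal.comp (continuous_modularFn.comp
      (QuotientGroup.continuous_mk.comp continuous_inv))).mul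
      (Complex.continuous_conj.comp (ψ.continuous.comp continuous_inv))
  · refine IsCompact.of_isClosed_subset ψ.isCompact_image.inv ?_ ?_
    · rw [image_tsupport_eq (norm_covariant hcov)]
      exact isClosed_tsupport _
    · rintro _ ⟨x, hx, rfl⟩
      refine ⟨x⁻¹, ?_, rfl⟩
      have hc : IsClosed ((fun x : G => x⁻¹) ⁻¹' tsupport ψ) :=
        (isClosed_tsupport _).preimage continuous_inv
      refine closure_minimal (fun y hy => ?_) hc hx
      refine subset_tsupport _ fun h => hy ?_
      simp [involFun, h]

/-- The covariant convolution `ψ ♮ φ` on `C_ξ(G, N)`. -/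
def conv [BorelSpace (G ⧸ N)] [IsFiniteMeasureOnCompacts μ] [IsClosed (N : Set G)]
    (hξ : IsInvariantChar ξ) (ψ φ : CovFun ξ μ) : CovFun ξ μ :=
  ⟨convFun ψ φ, convFun_mem hξ ψ φ⟩

/-- The covariant involution `ψ^♮` on `C_ξ(G, N)`. -/
def invol [LocallyCompactSpace G] (hξ : IsInvariantChar ξ) (ψ : CovFun ξ μ) : CovFun ξ μ :=
  ⟨involFun ψ, involFun_mem hξ ψ⟩

end Operations

end CovFun

/-! ### Banach `*`-algebras -/

section Banach

variable {E : Type*} [NormedAddCommGroup E] [NormedSpace ℂ E]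

/-- The product `mul` makes the complex normed space `E` a Banach algebra. -/
structure IsBanachAlgebra (mul : E → E → E) : Prop where
  complete : CompleteSpace E
  add_mul : ∀ a b c, mul (a + b) c = mul a c + mul b c
  mul_add : ∀ a b c, mul a (b + c) = mul a b + mul a c
  smul_mul : ∀ (z : ℂ) (a b), mul (z • a) b = z • mul a b
  mul_smul : ∀ (z : ℂ) (a b), mul a (z • b) = z • mul a b
  mul_assoc : ∀ a b c, mul (mul a b) c = mul a (mul b c)
  norm_mul_le : ∀ a b, ‖mul a b‖ ≤ ‖a‖ * ‖b‖

/-- `star` is an isometric involution with respect to the product `mul`. -/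
structure IsIsometricInvolution (mul : E → E → E) (star : E → E) : Prop where
  add : ∀ a b, star (a + b) = star a + star b
  smul : ∀ (z : ℂ) (a), star (z • a) = conj z • star a
  star_star : ∀ a, star (star a) = a
  star_mul : ∀ a b, star (mul a b) = mul (star b) (star a)
  norm_star : ∀ a, ‖star a‖ = ‖a‖

/-- `E` is a Banach `*`-algebra with product `mul` and (isometric) involution `star`. -/
structure IsBanachStarAlgebra (mul : E → E → E) (star : E → E) : Prop extends
  IsBanachAlgebra mul, IsIsometricInvolution mul star

end Banach

end

end Covariant

/-! The proof is the one for `L¹` of the group `G/N`. Since `ξ` is unimodular and `G`-invariant,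
`|ψ|` and the integrand `ψ(y)φ(y⁻¹x)` are constant on cosets in `x` and `y` respectively, so every
estimate takes place on `G/N`.

The involution is isometric by the inversion formula `integral_modularFn_inv_mul_inv`, applied to
`|ψ|`. It reverses products by the substitution `y ↦ xy` (`invol_conv`). Submultiplicativity
(`norm_conv_le`) and associativity (`conv_assoc`) are Fubini followed by left invariance. All
integrands are continuous with compact support modulo `N`, so Fubini needs no σ-finiteness.

Bounded bilinear maps and isometries extend to the completion, and identities and inequalities valid
on a dense subspace persist by continuity; density also gives uniqueness. -/

namespace Covariant

/-! ### Compactly supported functions on a product -/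

section Fubini

variable {X Y E : Type*} [TopologicalSpace X] [TopologicalSpace Y] [NormedAddCommGroup E]

lemma hasCompactSupport_uncurry [R1Space X] [R1Space Y] {f : X → Y → E} {K : Set X} {L : Set Y}
    (hK : IsCompact K) (hL : IsCompact L) (h : ∀ x y, f x y ≠ 0 → x ∈ K ∧ y ∈ L) :
    HasCompactSupport f.uncurry := by
  refine HasCompactSupport.intro (hK.prod hL) ?_
  rintro ⟨x, y⟩ hxy
  by_contra hne
  exact hxy (h x y hne)

/-- The inner integral is again continuous, and it vanishes off the projection of the support. This
makes the majorant in `norm_conv_le` integrable. -/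
lemma integrable_integral_of_hasCompactSupport [NormedSpace ℝ E] [R1Space X]
    [MeasurableSpace X] [OpensMeasurableSpace X] [MeasurableSpace Y] [OpensMeasurableSpace Y]
    (μ : Measure X) (ν : Measure Y) [IsFiniteMeasureOnCompacts μ] [IsFiniteMeasureOnCompacts ν]
    {f : X → Y → E} (hf : Continuous f.uncurry) (hc : HasCompactSupport f.uncurry) :
    Integrable (fun x => ∫ y, f x y ∂ν) μ := by
  refine Continuous.integrable_of_hasCompactSupport ?_ ?_
  · rw [← continuousOn_univ]
    refine continuousOn_integral_of_compact_support (k := Prod.snd '' tsupport f.uncurry)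
      (hc.isCompact.image continuous_snd) hf.continuousOn fun x y _ hy => ?_
    by_contra hne
    exact hy ⟨(x, y), subset_tsupport _ hne, rfl⟩
  · refine HasCompactSupport.intro (hc.isCompact.image continuous_fst) fun x hx => ?_
    refine integral_eq_zero_of_ae (ae_of_all _ fun y => ?_)
    by_contra hne
    exact hx ⟨(x, y), subset_tsupport _ hne, rfl⟩

end Fubini

/-! ### The inversion formula for Haar measure -/

section Modular

variable {H : Type*} [Group H] [TopologicalSpace H] [IsTopologicalGroup H] [LocallyCompactSpace H]

lemma modularFn_mul (x y : H) : modularFn (x * y) = modularFn x * modularFn y := by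
  simp [modularFn, mul_comm]

lemma modularFn_inv_mul_self (x : H) : modularFn x⁻¹ * modularFn x = 1 := by
  rw [← modularFn_mul, inv_mul_cancel]
  simp [modularFn]

/-- The inversion formula `∫ Δ(x⁻¹) f (x⁻¹) dx = ∫ f (x) dx` for left Haar measures. -/
lemma integral_modularFn_inv_mul_inv [MeasurableSpace H] [BorelSpace H] (μ : Measure H)
    [μ.IsHaarMeasure] {f : H → ℝ} (hf : Continuous f) (hc : HasCompactSupport f) :
    ∫ x, modularFn x⁻¹ * f x⁻¹ ∂μ = ∫ x, f x ∂μ := by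
  -- An auxiliary `g` with nonzero integral turns the claim into one about double integrals, where
  -- inversion arises from the translations `x ↦ y⁻¹x` and `y ↦ xy`. The last integral over `x` is a
  -- right translate of `g`; its factor `Δ(y⁻¹)` cancels `Δ(y)`.
  obtain ⟨⟨g, g_cont⟩, g_comp, g_nonneg, g_one⟩ :
    ∃ g : C(H, ℝ), HasCompactSupport g ∧ 0 ≤ g ∧ g 1 ≠ 0 := exists_continuous_nonneg_pos 1
  change Continuous g at g_cont
  have hg : 0 < ∫ x, g x ∂μ :=
    g_cont.integral_pos_of_hasCompactSupport_nonneg_nonzero g_comp g_nonneg g_one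
  refine mul_left_cancel₀ hg.ne' ?_
  have hΔ := continuous_modularFn (H := H)
  calc (∫ y, g y ∂μ) * ∫ x, modularFn x⁻¹ * f x⁻¹ ∂μ
      = ∫ y, ∫ x, g y * (modularFn (x⁻¹ * y) * f (x⁻¹ * y)) ∂μ ∂μ := by
        rw [← integral_mul_const]
        congr 1 with y
        rw [integral_const_mul,
          ← integral_mul_left_eq_self (fun x => modularFn x⁻¹ * f x⁻¹) y⁻¹]
        simp
    _ = ∫ x, ∫ y, g y * (modularFn (x⁻¹ * y) * f (x⁻¹ * y)) ∂μ ∂μ := by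
        refine integral_integral_swap_of_hasCompactSupport ?_
          (hasCompactSupport_uncurry g_comp (g_comp.isCompact.mul hc.isCompact.inv) ?_)
        · have h : Continuous fun p : H × H => p.2⁻¹ * p.1 := continuous_snd.inv.mul continuous_fst
          exact (g_cont.comp continuous_fst).mul ((hΔ.comp h).mul (hf.comp h))
        · intro y x h
          have hy := subset_tsupport _ (left_ne_zero_of_mul h)
          refine ⟨hy, y, hy, y⁻¹ * x, ?_, by simp⟩
          simpa using subset_tsupport f (right_ne_zero_of_mul (right_ne_zero_of_mul h))
    _ = ∫ x, ∫ y, g (x * y) * (modularFn y * f y) ∂μ ∂μ := by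
        congr 1 with x
        rw [← integral_mul_left_eq_self _ x]
        simp
    _ = ∫ y, ∫ x, g (x * y) * (modularFn y * f y) ∂μ ∂μ := by
        refine integral_integral_swap_of_hasCompactSupport ?_
          (hasCompactSupport_uncurry (g_comp.isCompact.mul hc.isCompact.inv) hc ?_)
        · exact (g_cont.comp continuous_mul).mul
            ((hΔ.comp continuous_snd).mul (hf.comp continuous_snd))
        · intro x y h
          have hy := subset_tsupport f (right_ne_zero_of_mul (right_ne_zero_of_mul h))
          exact ⟨⟨x * y, subset_tsupport _ (left_ne_zero_of_mul h), y⁻¹, Set.inv_mem_inv.2 hy,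
            by simp⟩, hy⟩
    _ = (∫ y, g y ∂μ) * ∫ y, f y ∂μ := by
        rw [← integral_const_mul]
        congr 1 with y
        rw [integral_mul_const, integral_mul_right_eq_modularFn μ g_cont g_comp]
        linear_combination (∫ y, g y ∂μ) * f y * modularFn_inv_mul_self y

end Modular

/-! ### Integration and continuity on `G/N` through representatives -/

section Descend

variable {G : Type*} [Group G] {N : Subgroup G} {E : Type*}

variable [TopologicalSpace G] [IsTopologicalGroup G] [NormedAddCommGroup E]

lemma integral_descend_mul_left [N.Normal] [MeasurableSpace (G ⧸ N)] [BorelSpace (G ⧸ N)]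
    [NormedSpace ℝ E] {μ : Measure (G ⧸ N)} [μ.IsMulLeftInvariant] {f : G → E}
    (hf : ∀ x, ∀ s : N, f (x * s) = f x) (x : G) :
    ∫ q, descend N (fun y => f (x * y)) q ∂μ = ∫ q, descend N f q ∂μ := by
  rw [← integral_mul_left_eq_self (descend N f) (x : G ⧸ N)]
  congr 1 with q
  obtain ⟨y, rfl⟩ := QuotientGroup.mk_surjective q
  rw [← QuotientGroup.mk_mul, descend_mk hf,
    descend_mk (f := fun y => f (x * y)) fun y s => by rw [← mul_assoc, hf]]

variable {f : G → G → E}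

/-- The choice `q.out` need not be continuous, but coset invariance removes its effect. Continuity
descends because a product of open quotient maps is again a quotient map. -/
lemma continuous_uncurry_out (hf : Continuous f.uncurry)
    (h1 : ∀ x y, ∀ s : N, f (x * s) y = f x y) (h2 : ∀ x y, ∀ s : N, f x (y * s) = f x y) :
    Continuous (Function.uncurry fun q r : G ⧸ N => f q.out r.out) := by
  have hq := QuotientGroup.isOpenQuotientMap_mk (N := N)
  rw [← (hq.prodMap hq).continuous_comp_iff]
  convert hf using 1
  funext p
  change descend N (fun x => f x (p.2 : G ⧸ N).out) p.1 = _
  rw [descend_mk fun x s => h1 x _ s]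
  exact descend_mk (h2 p.1) p.2

lemma hasCompactSupport_uncurry_out [N.Normal] {K L : Set (G ⧸ N)} (hK : IsCompact K) (hL : IsCompact L)
    (h : ∀ x y, f x y ≠ 0 → (x : G ⧸ N) ∈ K ∧ (y : G ⧸ N) ∈ L) :
    HasCompactSupport (Function.uncurry fun q r : G ⧸ N => f q.out r.out) :=
  hasCompactSupport_uncurry hK hL fun q r hqr => by simpa using h _ _ hqr

end Descend

end Covariant

namespace Covariant

/-! ### Involution and convolution on `C_ξ(G, N)` -/

section Operations

variable {G : Type*} [Group G] [TopologicalSpace G] [IsTopologicalGroup G] {N : Subgroup G}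
  [MeasurableSpace (G ⧸ N)] {ξ : N →ₜ* Circle} {μ : Measure (G ⧸ N)}

lemma CovFun.mk_mem_image_tsupport {ψ : CovFun ξ μ} {x : G} (h : ψ x ≠ 0) :
    (x : G ⧸ N) ∈ ((↑) : G → G ⧸ N) '' tsupport ψ :=
  ⟨x, subset_tsupport _ h, rfl⟩

section Involution

variable [N.Normal] [LocallyCompactSpace G] (hξ : IsInvariantChar ξ)

lemma invol_apply (ψ : CovFun ξ μ) (x : G) :
    invol hξ ψ x = (modularFn ((x⁻¹ : G) : G ⧸ N) : ℂ) * conj (ψ x⁻¹) := rfl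

lemma invol_invol (ψ : CovFun ξ μ) : invol hξ (invol hξ ψ) = ψ := by
  refine DFunLike.ext _ _ fun x => ?_
  have h : (modularFn ((x : G ⧸ N)⁻¹) : ℂ) * modularFn (x : G ⧸ N) = 1 := by
    exact_mod_cast modularFn_inv_mul_self (x : G ⧸ N)
  simp only [invol_apply, inv_inv, _root_.map_mul, Complex.conj_ofReal, Complex.conj_conj,
    QuotientGroup.mk_inv]
  linear_combination ψ x * h

lemma invol_add (ψ φ : CovFun ξ μ) : invol hξ (ψ + φ) = invol hξ ψ + invol hξ φ := by
  refine DFunLike.ext _ _ fun x => ?_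
  simp [invol_apply, mul_add]

lemma invol_smul (z : ℂ) (ψ : CovFun ξ μ) : invol hξ (z • ψ) = conj z • invol hξ ψ := by
  refine DFunLike.ext _ _ fun x => ?_
  simp [invol_apply, mul_left_comm]

/-- This is the inversion formula on `G/N` for the function induced by `|ψ|`. -/
lemma norm_invol [BorelSpace (G ⧸ N)] [μ.IsHaarMeasure] (ψ : CovFun ξ μ) : ‖invol hξ ψ‖ = ‖ψ‖ := by
  rw [CovFun.norm_def, CovFun.norm_def, ← integral_modularFn_inv_mul_inv μ
    ψ.continuous_descend_norm ψ.hasCompactSupport_descend_norm]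
  congr 1 with q
  obtain ⟨x, rfl⟩ := QuotientGroup.mk_surjective q
  rw [descend_mk (invol hξ ψ).norm_map_mul, ← QuotientGroup.mk_inv, descend_mk ψ.norm_map_mul]
  simp [invol_apply, abs_of_pos (modularFn_pos _)]

end Involution

section Convolution

variable [N.Normal]

lemma continuous_descend_convIntegrand (hξ : IsInvariantChar ξ) (ψ φ : CovFun ξ μ) (x : G) :
    Continuous (descend N fun y => ψ y * φ (y⁻¹ * x)) :=
  continuous_descend (fun y s => convIntegrand_mul hξ ψ φ x y s) <|
    ψ.continuous.mul (φ.continuous.comp (continuous_inv.mul continuous_const))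

lemma integral_descend_norm_inv_mul [BorelSpace (G ⧸ N)] [μ.IsMulLeftInvariant] (φ : CovFun ξ μ) (y : G) :
    ∫ q, descend N (fun x => ‖φ (y⁻¹ * x)‖) q ∂μ = ‖φ‖ := by
  rw [CovFun.norm_def]
  exact integral_descend_mul_left (f := fun x => ‖φ x‖) φ.norm_map_mul y⁻¹

variable [BorelSpace (G ⧸ N)] [IsFiniteMeasureOnCompacts μ] [IsClosed (N : Set G)] (hξ : IsInvariantChar ξ)

lemma conv_apply (ψ φ : CovFun ξ μ) (x : G) :
    conv hξ ψ φ x = ∫ q, descend N (fun y => ψ y * φ (y⁻¹ * x)) q ∂μ := rfl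

lemma integrable_descend_convIntegrand (hξ : IsInvariantChar ξ) (ψ φ : CovFun ξ μ) (x : G) :
    Integrable (descend N fun y => ψ y * φ (y⁻¹ * x)) μ := by
  refine (continuous_descend_convIntegrand hξ ψ φ x).integrable_of_hasCompactSupport <|
    HasCompactSupport.intro ψ.isCompact_image fun q hq => ?_
  by_contra hne
  exact hq (by simpa using CovFun.mk_mem_image_tsupport (left_ne_zero_of_mul hne))

lemma conv_add_left (ψ₁ ψ₂ φ : CovFun ξ μ) :
    conv hξ (ψ₁ + ψ₂) φ = conv hξ ψ₁ φ + conv hξ ψ₂ φ := by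
  refine DFunLike.ext _ _ fun x => ?_
  rw [CovFun.add_apply, conv_apply, conv_apply, conv_apply,
    ← integral_add (integrable_descend_convIntegrand hξ _ _ x)
      (integrable_descend_convIntegrand hξ _ _ x)]
  simp [descend, add_mul]

lemma conv_add_right (ψ φ₁ φ₂ : CovFun ξ μ) :
    conv hξ ψ (φ₁ + φ₂) = conv hξ ψ φ₁ + conv hξ ψ φ₂ := by
  refine DFunLike.ext _ _ fun x => ?_
  rw [CovFun.add_apply, conv_apply, conv_apply, conv_apply,
    ← integral_add (integrable_descend_convIntegrand hξ _ _ x)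
      (integrable_descend_convIntegrand hξ _ _ x)]
  simp [descend, mul_add]

lemma conv_smul_left (z : ℂ) (ψ φ : CovFun ξ μ) : conv hξ (z • ψ) φ = z • conv hξ ψ φ := by
  refine DFunLike.ext _ _ fun x => ?_
  rw [CovFun.smul_apply, conv_apply, conv_apply, ← integral_const_mul]
  simp [descend, mul_assoc]

lemma conv_smul_right (z : ℂ) (ψ φ : CovFun ξ μ) : conv hξ ψ (z • φ) = z • conv hξ ψ φ := by
  refine DFunLike.ext _ _ fun x => ?_
  rw [CovFun.smul_apply, conv_apply, conv_apply, ← integral_const_mul]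
  simp [descend, mul_left_comm]

/-- Substituting `y ↦ xy` on the right gives the integrand `φ^♮(xy) ψ^♮(y⁻¹)`, whose modular factors
`Δ((xy)⁻¹)` and `Δ(y)` multiply to `Δ(x⁻¹)`. -/
lemma invol_conv [LocallyCompactSpace G] [μ.IsMulLeftInvariant] (ψ φ : CovFun ξ μ) :
    invol hξ (conv hξ ψ φ) = conv hξ (invol hξ φ) (invol hξ ψ) := by
  refine DFunLike.ext _ _ fun x => ?_
  rw [conv_apply, invol_apply, conv_apply, ← integral_conj, ← integral_const_mul,
    ← integral_descend_mul_left (fun y s => convIntegrand_mul hξ (invol hξ φ) (invol hξ ψ) x y s) x]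
  congr 1 with q
  have h : (modularFn (((x * q.out)⁻¹ : G) : G ⧸ N) : ℂ) * modularFn ((q.out : G) : G ⧸ N) =
      modularFn ((x⁻¹ : G) : G ⧸ N) := by
    rw [← Complex.ofReal_mul, mul_comm, ← modularFn_mul, ← QuotientGroup.mk_mul]
    simp
  simp only [descend, invol_apply, ← h, _root_.map_mul, mul_inv_rev, inv_inv,
    inv_mul_cancel_right]
  ring

lemma norm_conv_le [μ.IsMulLeftInvariant] (ψ φ : CovFun ξ μ) :
    ‖conv hξ ψ φ‖ ≤ ‖ψ‖ * ‖φ‖ := by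
  let f : G → G → ℝ := fun x y => ‖ψ y‖ * ‖φ (y⁻¹ * x)‖
  have hf : Continuous f.uncurry := (ψ.continuous.comp continuous_snd).norm.mul
    (φ.continuous.comp (continuous_snd.inv.mul continuous_fst)).norm
  have h1 : ∀ x y, ∀ s : N, f (x * s) y = f x y := fun x y s => by
    simp only [f, ← mul_assoc, φ.norm_map_mul]
  have h2 : ∀ x y, ∀ s : N, f x (y * s) = f x y := fun x y s => by
    simp only [f, ← norm_mul, convIntegrand_mul hξ]
  have hcont := continuous_uncurry_out hf h1 h2
  have hsupp : HasCompactSupport (Function.uncurry fun q r : G ⧸ N => f q.out r.out) := by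
    refine hasCompactSupport_uncurry_out (ψ.isCompact_image.mul φ.isCompact_image)
      ψ.isCompact_image fun x y h => ?_
    have hy := CovFun.mk_mem_image_tsupport (norm_ne_zero_iff.1 (left_ne_zero_of_mul h))
    refine ⟨⟨_, hy, _, CovFun.mk_mem_image_tsupport
      (norm_ne_zero_iff.1 (right_ne_zero_of_mul h)), ?_⟩, hy⟩
    change (y : G ⧸ N) * ((y⁻¹ * x : G) : G ⧸ N) = x
    rw [← QuotientGroup.mk_mul, mul_inv_cancel_left]
  calc ‖conv hξ ψ φ‖ ≤ ∫ q, ∫ r, f q.out r.out ∂μ ∂μ := by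
        -- Only the majorant has to be shown integrable here.
        refine integral_mono_of_nonneg (ae_of_all _ fun q => norm_nonneg _)
          (integrable_integral_of_hasCompactSupport μ μ hcont hsupp) (ae_of_all _ fun q => ?_)
        refine (norm_integral_le_integral_norm _).trans_eq ?_
        simp [descend, f]
    _ = ∫ r, ∫ q, f q.out r.out ∂μ ∂μ := integral_integral_swap_of_hasCompactSupport hcont hsupp
    _ = ∫ r, descend N (fun y => ‖ψ y‖) r * ‖φ‖ ∂μ := by
        congr 1 with r
        rw [← integral_descend_norm_inv_mul φ r.out, ← integral_const_mul]
        rfl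
    _ = ‖ψ‖ * ‖φ‖ := integral_mul_const _ _

lemma conv_assoc [μ.IsMulLeftInvariant] (ψ φ χ : CovFun ξ μ) :
    conv hξ (conv hξ ψ φ) χ = conv hξ ψ (conv hξ φ χ) := by
  refine DFunLike.ext _ _ fun x => ?_
  -- Integrating over `y` and then `z` gives the left side. In the other order, `z ↦ yz` turns the
  -- inner integral into `ψ(y)` times `φ ♮ χ` at `y⁻¹x`.
  let f : G → G → ℂ := fun z y => ψ y * φ (y⁻¹ * z) * χ (z⁻¹ * x)
  have hf : Continuous f.uncurry := ((ψ.continuous.comp continuous_snd).mul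
    (φ.continuous.comp (continuous_snd.inv.mul continuous_fst))).mul
    (χ.continuous.comp (continuous_fst.inv.mul continuous_const))
  have h1 : ∀ z y, ∀ s : N, f (z * s) y = f z y := fun z y s => by
    -- The base point `y⁻¹x` is chosen so that `(y⁻¹z)⁻¹(y⁻¹x) = z⁻¹x`.
    have h := convIntegrand_mul hξ φ χ (y⁻¹ * x) (y⁻¹ * z) s
    have h3 : ∀ w, (y⁻¹ * w)⁻¹ * (y⁻¹ * x) = w⁻¹ * x := fun w => by group
    rw [mul_assoc y⁻¹, h3, h3] at h
    simp only [f, mul_assoc (ψ y), h]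
  have h2 : ∀ z y, ∀ s : N, f z (y * s) = f z y := fun z y s => by
    simp only [f, convIntegrand_mul hξ]
  have hcont := continuous_uncurry_out hf h1 h2
  have hsupp : HasCompactSupport (Function.uncurry fun q r : G ⧸ N => f q.out r.out) := by
    -- The first two factors already confine both variables, as `z = y(y⁻¹z)`.
    refine hasCompactSupport_uncurry_out (ψ.isCompact_image.mul φ.isCompact_image)
      ψ.isCompact_image fun z y h => ?_
    have h' := left_ne_zero_of_mul h
    have hy := CovFun.mk_mem_image_tsupport (left_ne_zero_of_mul h')
    refine ⟨⟨_, hy, _, CovFun.mk_mem_image_tsupport (right_ne_zero_of_mul h'), ?_⟩, hy⟩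
    change (y : G ⧸ N) * ((y⁻¹ * z : G) : G ⧸ N) = z
    rw [← QuotientGroup.mk_mul, mul_inv_cancel_left]
  calc conv hξ (conv hξ ψ φ) χ x = ∫ q, ∫ r, f q.out r.out ∂μ ∂μ := by
        rw [conv_apply]
        congr 1 with q
        simp only [descend, f]
        rw [integral_mul_const, conv_apply]
        rfl
    _ = ∫ r, ∫ q, f q.out r.out ∂μ ∂μ := integral_integral_swap_of_hasCompactSupport hcont hsupp
    _ = conv hξ ψ (conv hξ φ χ) x := by
        rw [conv_apply]
        congr 1 with r
        change ∫ q, descend N (fun z => f z r.out) q ∂μ = ψ r.out * conv hξ φ χ (r.out⁻¹ * x)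
        rw [conv_apply, ← integral_const_mul,
          ← integral_descend_mul_left (fun z s => h1 z r.out s) r.out]
        congr 1 with q
        simp only [descend, f, inv_mul_cancel_left, mul_inv_rev, mul_assoc]

end Convolution

end Operations

/-! ### Extension to the completion -/

section Completion

open UniformSpace

variable {E : Type*} [NormedAddCommGroup E]

lemma completion_mul_unique {M M' : Completion E → Completion E → Completion E}
    (hM : Continuous fun p : Completion E × Completion E => M p.1 p.2)
    (hM' : Continuous fun p : Completion E × Completion E => M' p.1 p.2)
    (h : ∀ a b : E, M a b = M' a b) : M = M' := by
  funext a b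
  exact Completion.induction_on₂ a b (isClosed_eq hM hM') h

variable [NormedSpace ℂ E]

/-- A submultiplicative bilinear product on a normed space extends to its completion. -/
lemma exists_completion_mul {m : E → E → E} (add_mul : ∀ a b c, m (a + b) c = m a c + m b c)
    (mul_add : ∀ a b c, m a (b + c) = m a b + m a c)
    (smul_mul : ∀ (z : ℂ) (a b), m (z • a) b = z • m a b)
    (mul_smul : ∀ (z : ℂ) (a b), m a (z • b) = z • m a b)
    (norm_mul_le : ∀ a b, ‖m a b‖ ≤ ‖a‖ * ‖b‖) :
    ∃ M : Completion E → Completion E → Completion E,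
      Continuous (fun p : Completion E × Completion E => M p.1 p.2) ∧
      ∀ a b : E, M a b = (m a b : E) := by
  -- The norm bound, with constant `1`, serves to make `m` jointly continuous.
  let B : E →L[ℂ] E →L[ℂ] E :=
    (LinearMap.mk₂ ℂ m add_mul smul_mul mul_add mul_smul).mkContinuous₂ 1 fun a b => by
      simpa using norm_mul_le a b
  have hB : Continuous fun p : E × E => m p.1 p.2 :=
    B.continuous₂
  -- Biadditivity and joint continuity suffice for the extension; compatibility with complex scalars
  -- follows later by density.
  let β : E →+ E →+ Completion E := AddMonoidHom.mk' (fun a => AddMonoidHom.mk'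
    (fun b => ((m a b : E) : Completion E)) fun b c => by
      rw [mul_add, Completion.coe_add]) fun a b => by
      ext c
      simp [add_mul, Completion.coe_add]
  have hβ : Continuous fun p : E × E => β p.1 p.2 := (Completion.continuous_coe E).comp hB
  have di : IsDenseInducing (Completion.toCompl : E → Completion E) :=
    Completion.isDenseInducing_coe
  have hc := di.extend_Z_bilin di hβ
  refine ⟨fun a b => (di.prodMap di).extend (fun p : E × E => β p.1 p.2) (a, b), hc, fun a b => ?_⟩
  exact (di.prodMap di).extend_eq hβ (a, b)

/-- Each axiom is a closed condition on tuples in the completion, so it needs checking only on the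
dense image of `E`. -/
lemma isBanachAlgebra_completion {m : E → E → E}
    {M : Completion E → Completion E → Completion E}
    (hM : Continuous fun p : Completion E × Completion E => M p.1 p.2)
    (hm : ∀ a b : E, M a b = (m a b : E))
    (add_mul : ∀ a b c, m (a + b) c = m a c + m b c)
    (mul_add : ∀ a b c, m a (b + c) = m a b + m a c)
    (smul_mul : ∀ (z : ℂ) (a b), m (z • a) b = z • m a b)
    (mul_smul : ∀ (z : ℂ) (a b), m a (z • b) = z • m a b)
    (mul_assoc : ∀ a b c, m (m a b) c = m a (m b c))
    (norm_mul_le : ∀ a b, ‖m a b‖ ≤ ‖a‖ * ‖b‖) : IsBanachAlgebra M := by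
  have hM' {X : Type _} [TopologicalSpace X] {f g : X → Completion E} (hf : Continuous f)
      (hg : Continuous g) : Continuous fun x => M (f x) (g x) := hM.comp (hf.prodMk hg)
  have hsmul (z : ℂ) : Continuous fun a : Completion E => z • a := continuous_const_smul z
  refine ⟨inferInstance, fun a b c => ?_, fun a b c => ?_, fun z a b => ?_, fun z a b => ?_,
    fun a b c => ?_, fun a b => ?_⟩
  · refine Completion.induction_on₃ a b c (isClosed_eq (hM' (by fun_prop) (by fun_prop))
      ((hM' (by fun_prop) (by fun_prop)).add (hM' (by fun_prop) (by fun_prop)))) fun a b c => ?_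
    simp only [← Completion.coe_add, hm, add_mul]
  · refine Completion.induction_on₃ a b c (isClosed_eq (hM' (by fun_prop) (by fun_prop))
      ((hM' (by fun_prop) (by fun_prop)).add (hM' (by fun_prop) (by fun_prop)))) fun a b c => ?_
    simp only [← Completion.coe_add, hm, mul_add]
  · refine Completion.induction_on₂ a b (isClosed_eq (hM' ((hsmul z).comp continuous_fst) continuous_snd)
      ((hsmul z).comp hM)) fun a b => ?_
    simp only [← Completion.coe_smul, hm, smul_mul]
  · refine Completion.induction_on₂ a b (isClosed_eq (hM' continuous_fst ((hsmul z).comp continuous_snd))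
      ((hsmul z).comp hM)) fun a b => ?_
    simp only [← Completion.coe_smul, hm, mul_smul]
  · refine Completion.induction_on₃ a b c (isClosed_eq
      (hM' (hM' (by fun_prop) (by fun_prop)) (by fun_prop))
      (hM' (by fun_prop) (hM' (by fun_prop) (by fun_prop)))) fun a b c => ?_
    simp only [hm, mul_assoc]
  · refine Completion.induction_on₂ a b (isClosed_le (hM' (by fun_prop) (by fun_prop)).norm
      (by fun_prop)) fun a b => ?_
    simpa only [hm, Completion.norm_coe] using norm_mul_le a b

/-- An isometric involution of a normed algebra extends to the completion. -/
lemma exists_completion_star {m : E → E → E} {M : Completion E → Completion E → Completion E}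
    (hM : Continuous fun p : Completion E × Completion E => M p.1 p.2)
    (hm : ∀ a b : E, M a b = (m a b : E)) {s : E → E} (hs : IsIsometricInvolution m s) :
    ∃ S : Completion E → Completion E, Continuous S ∧ (∀ a : E, S a = (s a : E)) ∧
      IsIsometricInvolution M S := by
  have hM' {X : Type _} [TopologicalSpace X] {f g : X → Completion E} (hf : Continuous f)
      (hg : Continuous g) : Continuous fun x => M (f x) (g x) := hM.comp (hf.prodMk hg)
  have hsmul (z : ℂ) : Continuous fun a : Completion E => z • a := continuous_const_smul z
  -- `Completion.map s` is continuous in any case; its agreement with `s` on `E` uses uniform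
  -- continuity, which holds because an additive norm-preserving map is an isometry.
  have hu : UniformContinuous s := by
    let σ : E →+ E := AddMonoidHom.mk' s hs.add
    exact (AddMonoidHomClass.isometry_of_norm σ hs.norm_star).uniformContinuous
  have hS : Continuous (Completion.map s) := Completion.continuous_map
  have hSs (a : E) : Completion.map s a = (s a : E) := Completion.map_coe hu a
  refine ⟨Completion.map s, hS, hSs, fun a b => ?_, fun z a => ?_, fun a => ?_, fun a b => ?_,
    fun a => ?_⟩
  · refine Completion.induction_on₂ a b (isClosed_eq (by fun_prop) (by fun_prop)) fun a b => ?_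
    simp only [← Completion.coe_add, hSs, hs.add]
  · refine Completion.induction_on a (isClosed_eq (hS.comp (hsmul z))
      ((hsmul _).comp hS)) fun a => ?_
    simp only [← Completion.coe_smul, hSs, hs.smul]
  · refine Completion.induction_on a (isClosed_eq (by fun_prop) (by fun_prop)) fun a => ?_
    simp only [hSs, hs.star_star]
  · refine Completion.induction_on₂ a b (isClosed_eq (hS.comp hM)
      (hM' (by fun_prop) (by fun_prop))) fun a b => ?_
    simp only [hm, hSs, hs.star_mul]
  · refine Completion.induction_on a (isClosed_eq (by fun_prop) (by fun_prop)) fun a => ?_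
    simp only [hSs, Completion.norm_coe, hs.norm_star]

end Completion

end Covariant

/-! ### The theorem -/

open Covariant in
theorem mainTheorem7 {G : Type*} [Group G] [TopologicalSpace G] [IsTopologicalGroup G]
    [LocallyCompactSpace G] [T2Space G] (N : Subgroup G) [N.Normal] [IsClosed (N : Set G)]
    (ξ : N →ₜ* Circle) (hξ : IsInvariantChar ξ)
    [MeasurableSpace (G ⧸ N)] [BorelSpace (G ⧸ N)]
    (μ : MeasureTheory.Measure (G ⧸ N)) [μ.IsHaarMeasure] [μ.Regular] :
    (∀ ψ : CovFun ξ μ, ‖invol hξ ψ‖ = ‖ψ‖) ∧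
    (∀ ψ : CovFun ξ μ, invol hξ (invol hξ ψ) = ψ) ∧
    (∀ ψ φ : CovFun ξ μ, invol hξ (conv hξ ψ φ) = conv hξ (invol hξ φ) (invol hξ ψ)) ∧
    ∃ mul : L1Cov ξ μ → L1Cov ξ μ → L1Cov ξ μ,
      -- `mul` is the unique continuous extension of the covariant convolution
      Continuous (fun p : L1Cov ξ μ × L1Cov ξ μ => mul p.1 p.2) ∧
      (∀ ψ φ : CovFun ξ μ, mul ψ φ = (conv hξ ψ φ : CovFun ξ μ)) ∧
      (∀ mul' : L1Cov ξ μ → L1Cov ξ μ → L1Cov ξ μ,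
        Continuous (fun p : L1Cov ξ μ × L1Cov ξ μ => mul' p.1 p.2) →
        (∀ ψ φ : CovFun ξ μ, mul' ψ φ = (conv hξ ψ φ : CovFun ξ μ)) → mul' = mul) ∧
      ∃ star : L1Cov ξ μ → L1Cov ξ μ,
        -- `star` extends the covariant involution to an isometric involution of a Banach `*`-algebra
        (∀ ψ : CovFun ξ μ, star ψ = (invol hξ ψ : CovFun ξ μ)) ∧
        IsBanachStarAlgebra mul star ∧
        -- it is the only continuous extension, in particular the only isometric one
        (∀ star' : L1Cov ξ μ → L1Cov ξ μ, Continuous star' →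
          (∀ ψ : CovFun ξ μ, star' ψ = (invol hξ ψ : CovFun ξ μ)) → star' = star) := by
  have hinv : IsIsometricInvolution (conv (μ := μ) hξ) (invol hξ) :=
    ⟨invol_add hξ, invol_smul hξ, invol_invol hξ, invol_conv hξ, norm_invol hξ⟩
  refine ⟨norm_invol hξ, invol_invol hξ, invol_conv hξ, ?_⟩
  obtain ⟨mul, hmul, hext⟩ := exists_completion_mul (conv_add_left (μ := μ) hξ)
    (conv_add_right hξ) (conv_smul_left hξ) (conv_smul_right hξ) (norm_conv_le hξ)
  obtain ⟨star, hstar, hsext, hsinv⟩ := exists_completion_star hmul hext hinv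
  refine ⟨mul, hmul, hext, fun mul' hmul' hext' => completion_mul_unique hmul' hmul fun ψ φ => by
    rw [hext', hext], star, hsext, ⟨isBanachAlgebra_completion hmul hext (conv_add_left hξ)
      (conv_add_right hξ) (conv_smul_left hξ) (conv_smul_right hξ) (conv_assoc hξ)
      (norm_conv_le hξ), hsinv⟩, fun star' hstar' hext' =>
    UniformSpace.Completion.ext hstar' hstar fun ψ => by rw [hext', hsext]⟩
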